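/- Let $m,n,p,r$ be natural numbers, $t=\min\{m,n\}$, let $\Phi:\mathbb{R}^{m\times n}\to\mathbb{R}^p$ be a linear map and $b_0\in\mathbb{R}^p$. For $X\in\mathbb{R}^{m\times n}$ let $\sigma_1(X)\ge\dots\ge\sigma_t(X)\ge 0$ be its singular values, $\|X\|_*=\sum_{i=1}^t\sigma_i(X)$ its nuclear norm and $\|X\|_F$ its Frobenius norm. Consider the nuclear norm minimization problem $$\min_X \|X\|_*\quad\text{s.t.}\quad \Phi X=b_0. \tag{NP}$$ Let $X_0\in\mathbb{R}^{m\times n}$ have rank $r$ and be feasible for (NP), that is, $\Phi X_0=b_0$. If $$\sum_{i=1}^{r}\sigma_i(H)<\sum_{i=r+1}^{t}\sigma_i(H)\qquad\text{for all } H\in\operatorname{Ker}\Phi\setminus\{0\},$$ then $X_0$ is a sharp minimum of (NP): there exist $\kappa,\delta>0$ such that $$\|X\|_*-\|X_0\|_*\ge\kappa\,\|X-X_0\|_F\qquad\text{for all } X \text{ with } \Phi X=b_0 \text{ and } \|X-X_0\|_F\le\delta.$$ -/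

import Mathlib

open scoped Matrix.Norms.Frobenius

/-- The singular values of a real `m × n` matrix in descending order, indexed from `0`:
`matrixSingularValue X i` is `σ_{i+1}(X)`. -/
noncomputable def matrixSingularValue {m n : ℕ} (X : Matrix (Fin m) (Fin n) ℝ) (i : ℕ) : ℝ :=
  (Matrix.toLpLin 2 2 X).singularValues i

/-- The nuclear norm `‖X‖_* = σ₁(X) + ⋯ + σ_t(X)` with `t = min {m, n}`. -/
noncomputable def nuclearNorm {m n : ℕ} (X : Matrix (Fin m) (Fin n) ℝ) : ℝ :=
  ∑ i ∈ Finset.range (min m n), matrixSingularValue X i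

/-- `x₀` is a sharp minimum of the problem `min f(x)` subject to `x ∈ S`. -/
def IsSharpMinimum {E : Type*} [NormedAddCommGroup E] (f : E → ℝ) (S : Set E) (x₀ : E) : Prop :=
  x₀ ∈ S ∧ ∃ κ > 0, ∃ δ > 0, ∀ x ∈ S, ‖x - x₀‖ ≤ δ → κ * ‖x - x₀‖ ≤ f x - f x₀

/-- The feasible set `{X : Φ X = b₀}` of the nuclear norm minimization problem. -/
def nuclearFeasibleSet {m n p : ℕ}
    (Φ : Matrix (Fin m) (Fin n) ℝ →ₗ[ℝ] EuclideanSpace ℝ (Fin p))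
    (b₀ : EuclideanSpace ℝ (Fin p)) : Set (Matrix (Fin m) (Fin n) ℝ) :=
  {X | Φ X = b₀}

/-- `X₀` is a sharp minimum of `min ‖X‖_*` subject to `Φ X = b₀`; the distance
between matrices is measured in the Frobenius norm. -/
def IsSharpNuclearMinimum {m n p : ℕ}
    (Φ : Matrix (Fin m) (Fin n) ℝ →ₗ[ℝ] EuclideanSpace ℝ (Fin p))
    (b₀ : EuclideanSpace ℝ (Fin p)) (X₀ : Matrix (Fin m) (Fin n) ℝ) : Prop :=
  IsSharpMinimum nuclearNorm (nuclearFeasibleSet Φ b₀) X₀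

/-! The function `nuclearGap r` is continuous and absolutely homogeneous, and the hypothesis makes
it positive on the kernel away from `0`. Compactness of the unit sphere then bounds it below there
by a multiple of the Frobenius norm. It remains to see that moving from a rank-`r` matrix along `H`
raises the nuclear norm by at least `nuclearGap r H`.

This is a Mirsky-type inequality for `A = X₀` and `B = -H`, proved on self-adjoint dilations. Let `P
≥ 0` majorize the dilation of `A - B` with trace at most its nuclear norm. Then `M = B.dilation + P`
dominates both dilations and has the trace of `P`. Each eigenvalue of `M` may thus be bounded below
through whichever of `A`, `B` is better at that index; summing gives the inequality. -/

open Module in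
theorem Submodule.exists_mem_inf_ne_zero_of_finrank_lt {E : Type*} [AddCommGroup E] [Module ℝ E]
    [FiniteDimensional ℝ E] (V W : Submodule ℝ E)
    (h : finrank ℝ E < finrank ℝ V + finrank ℝ W) : ∃ x ∈ V, x ∈ W ∧ x ≠ 0 := by
  have h1 := Submodule.finrank_sup_add_finrank_inf_eq V W
  have h2 := Submodule.finrank_le (V ⊔ W)
  have h3 : V ⊓ W ≠ ⊥ := by
    intro h0
    rw [h0, finrank_bot] at h1
    omega
  obtain ⟨x, hx, hx0⟩ := Submodule.exists_mem_ne_zero_of_ne_bot h3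
  exact ⟨x, hx.1, hx.2, hx0⟩

/-! ### Symmetric maps and eigenvalue bounds -/

section InnerProduct

theorem OrthonormalBasis.sq_norm_eq_sum {E : Type*} [NormedAddCommGroup E]
    [InnerProductSpace ℝ E] {n : ℕ} (b : OrthonormalBasis (Fin n) ℝ E) (x : E) :
    ‖x‖ ^ 2 = ∑ j, inner ℝ (b j) x ^ 2 := by
  simpa using (b.sum_sq_norm_inner_right x).symm

variable {E F : Type*} [NormedAddCommGroup E] [InnerProductSpace ℝ E] [FiniteDimensional ℝ E]
  [NormedAddCommGroup F] [InnerProductSpace ℝ F] [FiniteDimensional ℝ F]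

/-- Vectors orthogonal to the members of the basis `b` with index in `s`. -/
noncomputable def OrthonormalBasis.coordKer {E : Type*} [NormedAddCommGroup E]
    [InnerProductSpace ℝ E] {n : ℕ} (b : OrthonormalBasis (Fin n) ℝ E) (s : Finset (Fin n)) :
    Submodule ℝ E :=
  (Submodule.span ℝ (b '' s))ᗮ

theorem OrthonormalBasis.inner_eq_zero_of_mem_coordKer {E : Type*} [NormedAddCommGroup E]
    [InnerProductSpace ℝ E] {n : ℕ} {b : OrthonormalBasis (Fin n) ℝ E}
    {s : Finset (Fin n)} {x : E} (hx : x ∈ b.coordKer s) {j : Fin n} (hj : j ∈ s) :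
    inner ℝ (b j) x = 0 :=
  (Submodule.mem_orthogonal _ x).1 hx _
    (Submodule.subset_span (Set.mem_image_of_mem b hj))

theorem OrthonormalBasis.le_finrank_coordKer {n : ℕ} (b : OrthonormalBasis (Fin n) ℝ E)
    (s : Finset (Fin n)) : n ≤ Module.finrank ℝ (b.coordKer s) + s.card := by
  classical
  have h1 := Submodule.finrank_add_finrank_orthogonal (Submodule.span ℝ (b '' s))
  have h2 := (finrank_span_finset_le_card (R := ℝ) (s.image b)).trans Finset.card_image_le
  have h3 := Module.finrank_eq_card_basis b.toBasis
  rw [Fintype.card_fin] at h3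
  rw [Set.finrank, Finset.coe_image] at h2
  unfold OrthonormalBasis.coordKer
  omega

theorem LinearMap.IsSymmetric.inner_apply_self_eq_sum {M : E →ₗ[ℝ] E} (hM : M.IsSymmetric) {n : ℕ}
    (hn : Module.finrank ℝ E = n) (x : E) :
    inner ℝ (M x) x = ∑ j, hM.eigenvalues hn j * inner ℝ (hM.eigenvectorBasis hn j) x ^ 2 := by
  rw [← (hM.eigenvectorBasis hn).sum_inner_mul_inner]
  refine Finset.sum_congr rfl fun j _ => ?_
  rw [hM, hM.apply_eigenvectorBasis, inner_smul_right, real_inner_comm]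
  simp
  ring

/-- A quadratic form bounded below by `c` on a subspace of dimension greater than `k` has its `k`-th
eigenvalue at least `c`. -/
theorem LinearMap.IsSymmetric.le_eigenvalues {M : E →ₗ[ℝ] E} (hM : M.IsSymmetric) {n : ℕ}
    (hn : Module.finrank ℝ E = n) (k : Fin n) (c : ℝ) (V : Submodule ℝ E)
    (hV : (k : ℕ) < Module.finrank ℝ V) (hc : ∀ x ∈ V, c * ‖x‖ ^ 2 ≤ inner ℝ (M x) x) :
    c ≤ hM.eigenvalues hn k := by
  set b := hM.eigenvectorBasis hn
  have h1 := b.le_finrank_coordKer (Finset.Iio k)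
  rw [Fin.card_Iio] at h1
  obtain ⟨x, hxV, hxW, hx0⟩ := Submodule.exists_mem_inf_ne_zero_of_finrank_lt V
    (b.coordKer (Finset.Iio k)) (by omega)
  have h2 : inner ℝ (M x) x ≤ hM.eigenvalues hn k * ‖x‖ ^ 2 := by
    rw [hM.inner_apply_self_eq_sum hn, b.sq_norm_eq_sum, Finset.mul_sum]
    refine Finset.sum_le_sum fun j _ => ?_
    by_cases hj : j < k
    · have := OrthonormalBasis.inner_eq_zero_of_mem_coordKer hxW (Finset.mem_Iio.2 hj)
      simp [b] at this
      simp [b, this]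
    · exact mul_le_mul_of_nonneg_right (hM.eigenvalues_antitone hn (not_lt.1 hj)) (sq_nonneg _)
  exact le_of_mul_le_mul_right ((hc x hxV).trans h2) (by positivity)

/-! ### Singular values: decomposition, min-max, perturbation -/

/-- Singular value decomposition; the left vectors belonging to the value `0` are taken to be `0`. -/
theorem LinearMap.exists_singularValueDecomposition (T : E →ₗ[ℝ] F) {n : ℕ}
    (hn : Module.finrank ℝ E = n) :
    ∃ (v : OrthonormalBasis (Fin n) ℝ E) (u : Fin n → F),
      (∀ j, T (v j) = T.singularValues j • u j) ∧ (∀ j, ‖u j‖ ≤ 1) ∧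
      (∀ i j, i ≠ j → inner ℝ (u i) (u j) = 0) ∧
      (∀ j x, inner ℝ (T x) (u j) = T.singularValues j * inner ℝ (v j) x) ∧
      ∀ x, ‖T x‖ ^ 2 = ∑ j : Fin n, T.singularValues j ^ 2 * inner ℝ (v j) x ^ 2 := by
  have hS := T.isSymmetric_adjoint_comp_self
  set v := hS.eigenvectorBasis hn with hv
  have hin : ∀ i j, inner ℝ (T (v i)) (T (v j)) =
      if i = j then T.singularValues i ^ 2 else 0 := by
    intro i j
    rw [← LinearMap.adjoint_inner_left, ← LinearMap.comp_apply, hv, hS.apply_eigenvectorBasis,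
      ← T.sq_singularValues_fin hn, inner_smul_left, orthonormal_iff_ite.1 v.orthonormal]
    simp
  have hnorm : ∀ j, ‖T (v j)‖ = T.singularValues j := by
    intro j
    have := hin j j
    rw [real_inner_self_eq_norm_sq, if_pos rfl] at this
    exact (sq_eq_sq₀ (norm_nonneg _) (T.singularValues_nonneg _)).1 this
  refine ⟨v, fun j => (T.singularValues j)⁻¹ • T (v j), fun j => ?_, fun j => ?_,
    fun i j hij => ?_, fun j x => ?_, fun x => ?_⟩
  · by_cases h : T.singularValues j = 0
    · have := hnorm j
      rw [h, norm_eq_zero] at this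
      simp [this]
    · rw [smul_smul, mul_inv_cancel₀ h, one_smul]
  · rw [norm_smul, hnorm, norm_inv, Real.norm_of_nonneg (T.singularValues_nonneg _)]
    exact inv_mul_le_one
  · rw [inner_smul_left, inner_smul_right, hin, if_neg hij]
    simp
  · rw [real_inner_comm, inner_smul_left, ← LinearMap.adjoint_inner_left, ← LinearMap.comp_apply,
      hv, hS.apply_eigenvectorBasis, ← T.sq_singularValues_fin hn, inner_smul_left]
    by_cases h : T.singularValues j = 0
    · simp [h]
    · simp
      field_simp
  · rw [← real_inner_self_eq_norm_sq, ← LinearMap.adjoint_inner_left, ← LinearMap.comp_apply,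
      hS.inner_apply_self_eq_sum hn]
    simp_rw [← T.sq_singularValues_fin hn]
    rfl

theorem LinearMap.exists_singularValues_mul_norm_le (T : E →ₗ[ℝ] F) {k : ℕ}
    (hk : k < Module.finrank ℝ E) :
    ∃ V : Submodule ℝ E, k < Module.finrank ℝ V ∧ ∀ x ∈ V, T.singularValues k * ‖x‖ ≤ ‖T x‖ := by
  obtain ⟨v, u, -, -, -, -, h⟩ := T.exists_singularValueDecomposition rfl
  have h1 := v.le_finrank_coordKer (Finset.Ioi ⟨k, hk⟩)
  rw [Fin.card_Ioi] at h1
  refine ⟨v.coordKer (Finset.Ioi ⟨k, hk⟩), by dsimp at h1; omega, fun x hx => ?_⟩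
  refine le_of_sq_le_sq ?_ (norm_nonneg _)
  rw [mul_pow, h, v.sq_norm_eq_sum, Finset.mul_sum]
  refine Finset.sum_le_sum fun j _ => ?_
  by_cases hj : ⟨k, hk⟩ < j
  · simp [OrthonormalBasis.inner_eq_zero_of_mem_coordKer hx (Finset.mem_Ioi.2 hj)]
  · refine mul_le_mul_of_nonneg_right (pow_le_pow_left₀ (T.singularValues_nonneg _)
      (T.singularValues_antitone (not_lt.1 hj)) _) (sq_nonneg _)

theorem LinearMap.exists_norm_le_singularValues_mul (T : E →ₗ[ℝ] F) (k : ℕ) :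
    ∃ V : Submodule ℝ E, Module.finrank ℝ E ≤ Module.finrank ℝ V + k ∧
      ∀ x ∈ V, ‖T x‖ ≤ T.singularValues k * ‖x‖ := by
  by_cases hk : k < Module.finrank ℝ E
  swap
  · exact ⟨⊥, by omega, by simp⟩
  obtain ⟨v, u, -, -, -, -, h⟩ := T.exists_singularValueDecomposition rfl
  have h1 := v.le_finrank_coordKer (Finset.Iio ⟨k, hk⟩)
  rw [Fin.card_Iio] at h1
  refine ⟨v.coordKer (Finset.Iio ⟨k, hk⟩), h1, fun x hx => ?_⟩
  refine le_of_sq_le_sq ?_ (mul_nonneg (T.singularValues_nonneg _) (norm_nonneg _))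
  rw [mul_pow, h, v.sq_norm_eq_sum, Finset.mul_sum]
  refine Finset.sum_le_sum fun j _ => ?_
  by_cases hj : j < ⟨k, hk⟩
  · simp [OrthonormalBasis.inner_eq_zero_of_mem_coordKer hx (Finset.mem_Iio.2 hj)]
  · refine mul_le_mul_of_nonneg_right (pow_le_pow_left₀ (T.singularValues_nonneg _)
      (T.singularValues_antitone (not_lt.1 hj)) _) (sq_nonneg _)

/-- The min-max subspaces of `S` and `T` meet by dimension count, and a common nonzero vector
compares the two values. Taking `c = 0` yields homogeneity, `a = 1` Lipschitz continuity. -/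
theorem LinearMap.singularValues_le_of_norm_le (S T : E →ₗ[ℝ] F) {a c : ℝ} (ha : 0 ≤ a)
    (hc : 0 ≤ c) (h : ∀ x, ‖S x‖ ≤ a * ‖T x‖ + c * ‖x‖) (k : ℕ) :
    S.singularValues k ≤ a * T.singularValues k + c := by
  by_cases hk : k < Module.finrank ℝ E
  swap
  · rw [S.singularValues_of_finrank_le (not_lt.1 hk)]
    have := T.singularValues_nonneg k
    positivity
  obtain ⟨V, hV, hV'⟩ := S.exists_singularValues_mul_norm_le hk
  obtain ⟨W, hW, hW'⟩ := T.exists_norm_le_singularValues_mul k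
  obtain ⟨x, hxV, hxW, hx0⟩ := Submodule.exists_mem_inf_ne_zero_of_finrank_lt V W (by omega)
  refine le_of_mul_le_mul_right ?_ (norm_pos_iff.2 hx0)
  calc S.singularValues k * ‖x‖ ≤ ‖S x‖ := hV' x hxV
    _ ≤ a * ‖T x‖ + c * ‖x‖ := h x
    _ ≤ a * (T.singularValues k * ‖x‖) + c * ‖x‖ := by gcongr; exact hW' x hxW
    _ = _ := by ring

theorem LinearMap.singularValues_smul (c : ℝ) (T : E →ₗ[ℝ] F) (k : ℕ) :
    (c • T).singularValues k = |c| * T.singularValues k := by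
  by_cases hc : c = 0
  · simp [hc]
  have hc' : 0 < |c| := abs_pos.2 hc
  apply le_antisymm
  · simpa using singularValues_le_of_norm_le (c • T) T hc'.le le_rfl
      (fun x => by simp [norm_smul]) k
  · have := singularValues_le_of_norm_le T (c • T) (inv_pos.2 hc').le le_rfl
      (fun x => by simp [norm_smul, hc]) k
    rw [add_zero, inv_mul_eq_div, le_div_iff₀ hc'] at this
    linarith

theorem LinearMap.singularValues_neg (T : E →ₗ[ℝ] F) (k : ℕ) :
    (-T).singularValues k = T.singularValues k := by
  simpa using T.singularValues_smul (-1) k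

theorem LinearMap.continuous_singularValues (k : ℕ) :
    Continuous fun T : E →L[ℝ] F => (T : E →ₗ[ℝ] F).singularValues k := by
  refine (LipschitzWith.of_le_add_mul 1 fun S T => ?_).continuous
  simpa [dist_eq_norm] using singularValues_le_of_norm_le (S : E →ₗ[ℝ] F) T zero_le_one
    (norm_nonneg (S - T)) (fun x => by
      have h1 : S x = T x + (S - T) x := by simp
      have h2 := (S - T).le_opNorm x
      have h3 := norm_add_le (T x) ((S - T) x)
      simp only [ContinuousLinearMap.coe_coe]
      rw [h1]
      linarith) k

/-! ### The self-adjoint dilation -/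

/-- The self-adjoint dilation `(v, u) ↦ (T† u, T v)` of `T`. -/
noncomputable def LinearMap.dilation (T : E →ₗ[ℝ] F) : WithLp 2 (E × F) →ₗ[ℝ] WithLp 2 (E × F) :=
  (WithLp.linearEquiv 2 ℝ (E × F)).symm.conj
    (LinearMap.inl ℝ E F ∘ₗ (LinearMap.adjoint T ∘ₗ LinearMap.snd ℝ E F) +
      LinearMap.inr ℝ E F ∘ₗ (T ∘ₗ LinearMap.fst ℝ E F))

theorem LinearMap.dilation_apply (T : E →ₗ[ℝ] F) (x : WithLp 2 (E × F)) :
    T.dilation x = WithLp.toLp 2 (LinearMap.adjoint T x.snd, T x.fst) := by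
  simp [LinearMap.dilation, LinearEquiv.conj_apply]

theorem LinearMap.isSymmetric_dilation (T : E →ₗ[ℝ] F) : T.dilation.IsSymmetric := by
  intro x y
  simp [LinearMap.dilation_apply, LinearMap.adjoint_inner_left, LinearMap.adjoint_inner_right,
    add_comm]

theorem LinearMap.inner_dilation_self (T : E →ₗ[ℝ] F) (x : WithLp 2 (E × F)) :
    inner ℝ (T.dilation x) x = 2 * inner ℝ (T x.fst) x.snd := by
  simp [LinearMap.dilation_apply, LinearMap.adjoint_inner_left, real_inner_comm]
  ring

theorem LinearMap.trace_dilation (T : E →ₗ[ℝ] F) : LinearMap.trace ℝ _ T.dilation = 0 := by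
  rw [LinearMap.dilation, LinearMap.trace_conj', map_add, LinearMap.trace_comp_comm',
    LinearMap.trace_comp_comm' (T ∘ₗ LinearMap.fst ℝ E F) (LinearMap.inr ℝ E F),
    LinearMap.comp_assoc, LinearMap.comp_assoc]
  simp

/-- A positive majorant of the dilation whose trace is at most the sum of the singular values. -/
theorem LinearMap.exists_dilation_majorant (T : E →ₗ[ℝ] F) :
    ∃ P : WithLp 2 (E × F) →ₗ[ℝ] WithLp 2 (E × F), P.IsSymmetric ∧
      (∀ x, 0 ≤ inner ℝ (P x) x) ∧ (∀ x, inner ℝ (T.dilation x) x ≤ inner ℝ (P x) x) ∧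
      LinearMap.trace ℝ _ P ≤ ∑ j ∈ Finset.range (Module.finrank ℝ E), T.singularValues j := by
  obtain ⟨v, u, hvu, hu, -, -, -⟩ := T.exists_singularValueDecomposition rfl
  -- The `e j` with nonzero singular value are eigenvectors of the dilation for `σ_j`, of squared
  -- norm `2`; hence the weights `σ_j / 2` below.
  set e : Fin (Module.finrank ℝ E) → WithLp 2 (E × F) := fun j => WithLp.toLp 2 (v j, u j) with he
  have hP : ∀ x y, inner ℝ ((∑ j : Fin _, (T.singularValues j / 2) •
      (InnerProductSpace.rankOne ℝ (e j) (e j)).toLinearMap) x) y =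
      ∑ j : Fin _, T.singularValues j / 2 * (inner ℝ (e j) x * inner ℝ (e j) y) := by
    intro x y
    simp [LinearMap.sum_apply, sum_inner, inner_smul_left]
  refine ⟨∑ j : Fin _, (T.singularValues j / 2) • (InnerProductSpace.rankOne ℝ (e j) (e j)).toLinearMap,
    fun x y => ?_, fun x => ?_, fun x => ?_, ?_⟩
  · rw [hP, real_inner_comm, hP]
    exact Finset.sum_congr rfl fun j _ => by ring
  · rw [hP]
    exact Finset.sum_nonneg fun j _ => mul_nonneg
      (div_nonneg (T.singularValues_nonneg _) two_pos.le) (mul_self_nonneg _)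
  · rw [hP, LinearMap.inner_dilation_self]
    conv_lhs => rw [← v.sum_repr' x.fst]
    rw [map_sum, sum_inner, Finset.mul_sum]
    refine Finset.sum_le_sum fun j _ => ?_
    rw [map_smul, hvu, inner_smul_left, inner_smul_left, he]
    simp only [WithLp.prod_inner_apply, RCLike.conj_to_real]
    change _ ≤ T.singularValues j / 2 * ((inner ℝ (v j) x.fst + inner ℝ (u j) x.snd) *
      (inner ℝ (v j) x.fst + inner ℝ (u j) x.snd))
    nlinarith [mul_nonneg (T.singularValues_nonneg j)
      (sq_nonneg (inner ℝ (v j) x.fst - inner ℝ (u j) x.snd))]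
  · rw [map_sum, Finset.sum_range]
    refine Finset.sum_le_sum fun j _ => ?_
    rw [map_smul, InnerProductSpace.trace_rankOne, real_inner_self_eq_norm_sq,
      WithLp.prod_norm_sq_eq_of_L2, smul_eq_mul]
    have h1 : ‖u j‖ ^ 2 ≤ 1 := pow_le_one₀ (norm_nonneg _) (hu j)
    have h2 : ‖v j‖ = 1 := v.orthonormal.1 j
    have h3 := T.singularValues_nonneg j
    simp only [he, WithLp.toLp_fst, WithLp.toLp_snd, h2]
    nlinarith

/-- On the graph of the partial isometry `U : v j ↦ u j`, the form is `2 * ⟪T x, U x⟫`. For `x` in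
the span of the first `k + 1` right vectors this is at least `2 * σ_k * ‖x‖ ^ 2`, and `‖U x‖ ≤ ‖x‖`.
-/
theorem LinearMap.exists_singularValues_le_dilation (T : E →ₗ[ℝ] F) {k : ℕ}
    (hk : k < Module.finrank ℝ E) :
    ∃ V : Submodule ℝ (WithLp 2 (E × F)), k < Module.finrank ℝ V ∧
      ∀ x ∈ V, T.singularValues k * ‖x‖ ^ 2 ≤ inner ℝ (T.dilation x) x := by
  obtain ⟨v, u, hvu, hu, huo, hTu, -⟩ := T.exists_singularValueDecomposition rfl
  have h1 := v.le_finrank_coordKer (Finset.Ioi ⟨k, hk⟩)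
  rw [Fin.card_Ioi] at h1
  set U : E →ₗ[ℝ] F := v.toBasis.constr ℝ u with hU
  have hUv : ∀ x, U x = ∑ j, inner ℝ (v j) x • u j := by
    intro x
    conv_lhs => rw [← v.sum_repr' x]
    simp only [map_sum, map_smul]
    refine Finset.sum_congr rfl fun j _ => ?_
    rw [hU, ← v.coe_toBasis, Module.Basis.constr_basis]
  have hUnorm : ∀ x, ‖U x‖ ^ 2 = ∑ j, inner ℝ (v j) x ^ 2 * ‖u j‖ ^ 2 := by
    intro x
    rw [← real_inner_self_eq_norm_sq, hUv, sum_inner]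
    refine Finset.sum_congr rfl fun j _ => ?_
    rw [inner_sum, Finset.sum_eq_single j]
    · rw [inner_smul_left, inner_smul_right, real_inner_self_eq_norm_sq]
      simp; ring
    · intro i _ hij
      rw [inner_smul_left, inner_smul_right, huo j i hij.symm]
      simp
    · simp
  have hTU : ∀ x, inner ℝ (T x) (U x) =
      ∑ j : Fin _, T.singularValues j * inner ℝ (v j) x ^ 2 := by
    intro x
    rw [hUv, inner_sum]
    refine Finset.sum_congr rfl fun j _ => ?_
    rw [inner_smul_right, hTu]
    ring
  refine ⟨LinearMap.range ((WithLp.linearEquiv 2 ℝ (E × F)).symm.toLinearMap ∘ₗ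
    LinearMap.prod LinearMap.id U ∘ₗ (v.coordKer (Finset.Ioi ⟨k, hk⟩)).subtype), ?_, ?_⟩
  · rw [LinearMap.finrank_range_of_inj]
    · dsimp at h1
      omega
    · intro x y hxy
      exact Subtype.ext (congrArg WithLp.fst hxy)
  · rintro _ ⟨⟨x, hx⟩, rfl⟩
    rw [LinearMap.inner_dilation_self, WithLp.prod_norm_sq_eq_of_L2]
    change T.singularValues k * (‖x‖ ^ 2 + ‖U x‖ ^ 2) ≤ 2 * inner ℝ (T x) (U x)
    have h2 : ‖U x‖ ^ 2 ≤ ‖x‖ ^ 2 := by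
      rw [hUnorm, v.sq_norm_eq_sum]
      exact Finset.sum_le_sum fun j _ =>
        mul_le_of_le_one_right (sq_nonneg _) (pow_le_one₀ (norm_nonneg _) (hu j))
    have h3 : T.singularValues k * ‖x‖ ^ 2 ≤ inner ℝ (T x) (U x) := by
      rw [hTU, v.sq_norm_eq_sum, Finset.mul_sum]
      refine Finset.sum_le_sum fun j _ => ?_
      by_cases hj : ⟨k, hk⟩ < j
      · simp [OrthonormalBasis.inner_eq_zero_of_mem_coordKer hx (Finset.mem_Ioi.2 hj)]
      · exact mul_le_mul_of_nonneg_right (T.singularValues_antitone (not_lt.1 hj)) (sq_nonneg _)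
    nlinarith [mul_le_mul_of_nonneg_left h2 (T.singularValues_nonneg k)]

/-- Take `V × F`, where `T` is bounded by `σ_k` on `V` of codimension at most `k`; then apply
Cauchy–Schwarz and AM-GM. -/
theorem LinearMap.exists_neg_singularValues_le_dilation (T : E →ₗ[ℝ] F) (k : ℕ) :
    ∃ V : Submodule ℝ (WithLp 2 (E × F)),
      Module.finrank ℝ E + Module.finrank ℝ F ≤ Module.finrank ℝ V + k ∧
      ∀ x ∈ V, -T.singularValues k * ‖x‖ ^ 2 ≤ inner ℝ (T.dilation x) x := by
  obtain ⟨V, hV, hV'⟩ := T.exists_norm_le_singularValues_mul k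
  refine ⟨LinearMap.range ((WithLp.linearEquiv 2 ℝ (E × F)).symm.toLinearMap ∘ₗ
    LinearMap.prodMap V.subtype (LinearMap.id : F →ₗ[ℝ] F)), ?_, ?_⟩
  · rw [LinearMap.finrank_range_of_inj, Module.finrank_prod]
    · omega
    · intro x y hxy
      have h1 := congrArg WithLp.fst hxy
      have h2 := congrArg WithLp.snd hxy
      exact Prod.ext (Subtype.ext h1) h2
  · rintro _ ⟨⟨⟨x, hx⟩, y⟩, rfl⟩
    rw [LinearMap.inner_dilation_self, WithLp.prod_norm_sq_eq_of_L2]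
    change -T.singularValues k * (‖x‖ ^ 2 + ‖y‖ ^ 2) ≤ 2 * inner ℝ (T x) y
    have h1 := hV' x hx
    have h2 := neg_le_of_abs_le (abs_real_inner_le_norm (T x) y)
    have h3 := mul_le_mul_of_nonneg_right h1 (norm_nonneg y)
    have h4 := mul_nonneg (T.singularValues_nonneg k) (sq_nonneg (‖x‖ - ‖y‖))
    nlinarith

/-- A Mirsky-type inequality for the difference of `A` and `B`, with `A` of rank at most `r`. -/
theorem LinearMap.sum_singularValues_le_sum_singularValues_sub (A B : E →ₗ[ℝ] F) {r t : ℕ}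
    (hA : Module.finrank ℝ A.range ≤ r) (hrt : r ≤ t) (htE : t ≤ Module.finrank ℝ E)
    (htF : t ≤ Module.finrank ℝ F) :
    ∑ i ∈ Finset.range r, A.singularValues i + ∑ i ∈ Finset.Ico r t, B.singularValues i -
      ∑ i ∈ Finset.range r, B.singularValues i ≤
      ∑ i ∈ Finset.range (Module.finrank ℝ E), (A - B).singularValues i := by
  obtain ⟨P, hPs, hP0, hPC, hPt⟩ := (A - B).exists_dilation_majorant
  have hn : Module.finrank ℝ (WithLp 2 (E × F)) = Module.finrank ℝ E + Module.finrank ℝ F := by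
    rw [(WithLp.linearEquiv 2 ℝ (E × F)).finrank_eq, Module.finrank_prod]
  set N := Module.finrank ℝ E + Module.finrank ℝ F with hN
  have hM : (B.dilation + P).IsSymmetric := B.isSymmetric_dilation.add hPs
  have hMB : ∀ x, inner ℝ (B.dilation x) x ≤ inner ℝ ((B.dilation + P) x) x := fun x => by
    rw [LinearMap.add_apply, inner_add_left]
    linarith [hP0 x]
  have hMA : ∀ x, inner ℝ (A.dilation x) x ≤ inner ℝ ((B.dilation + P) x) x := fun x => by
    have := hPC x
    rw [LinearMap.inner_dilation_self, LinearMap.sub_apply, inner_sub_left] at this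
    rw [LinearMap.add_apply, inner_add_left, LinearMap.inner_dilation_self,
      LinearMap.inner_dilation_self]
    linarith
  have htr : ∑ i, hM.eigenvalues hn i ≤
      ∑ i ∈ Finset.range (Module.finrank ℝ E), (A - B).singularValues i := by
    have h := hM.trace_eq_sum_eigenvalues hn
    rw [map_add, LinearMap.trace_dilation, zero_add] at h
    rw [h] at hPt
    simpa using hPt
  refine le_trans ?_ htr
  -- Extending the eigenvalues by `0` lets their sum be cut into intervals of `ℕ`.
  set f : ℕ → ℝ := fun i => if h : i < N then hM.eigenvalues hn ⟨i, h⟩ else 0 with hf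
  have hle : ∀ i < N, ∀ (T : E →ₗ[ℝ] F) (c : ℝ) (V : Submodule ℝ (WithLp 2 (E × F))),
      (∀ x, inner ℝ (T.dilation x) x ≤ inner ℝ ((B.dilation + P) x) x) →
      i < Module.finrank ℝ V → (∀ x ∈ V, c * ‖x‖ ^ 2 ≤ inner ℝ (T.dilation x) x) → c ≤ f i := by
    intro i hi T c V h1 h2 h3
    rw [hf]
    simp only [hi, dif_pos]
    exact hM.le_eigenvalues hn ⟨i, hi⟩ c V h2 fun x hx => (h3 x hx).trans (h1 x)
  have hsum : ∑ i, hM.eigenvalues hn i = ∑ i ∈ Finset.range r, f i + ∑ i ∈ Finset.Ico r t, f i +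
      ∑ i ∈ Finset.Ico t (N - r), f i + ∑ i ∈ Finset.range r, f (N - 1 - i) := by
    have h1 : ∑ i, hM.eigenvalues hn i = ∑ i ∈ Finset.range N, f i := by
      rw [Finset.sum_range]
      exact Finset.sum_congr rfl fun i _ => by simp [hf]
    have h2 : ∑ i ∈ Finset.range r, f (N - 1 - i) = ∑ i ∈ Finset.Ico (N - r) N, f i := by
      rcases Nat.eq_zero_or_pos r with rfl | hr
      · simp
      rw [Finset.range_eq_Ico, Finset.sum_Ico_reflect _ _ (by omega)]
      congr 2 <;> omega
    rw [h1, h2, Finset.sum_range_add_sum_Ico _ hrt, Finset.sum_range_add_sum_Ico _ (by omega),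
      Finset.sum_range_add_sum_Ico _ (by omega)]
  rw [hsum]
  have s1 : ∑ i ∈ Finset.range r, A.singularValues i ≤ ∑ i ∈ Finset.range r, f i := by
    refine Finset.sum_le_sum fun i hi => ?_
    rw [Finset.mem_range] at hi
    obtain ⟨V, hV, hV'⟩ := A.exists_singularValues_le_dilation (k := i) (by omega)
    exact hle i (by omega) A _ V hMA hV hV'
  have s2 : ∑ i ∈ Finset.Ico r t, B.singularValues i ≤ ∑ i ∈ Finset.Ico r t, f i := by
    refine Finset.sum_le_sum fun i hi => ?_
    rw [Finset.mem_Ico] at hi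
    obtain ⟨V, hV, hV'⟩ := B.exists_singularValues_le_dilation (k := i) (by omega)
    exact hle i (by omega) B _ V hMB hV hV'
  -- The rank bound gives `σ_r(A) = 0`, so the dilation of `A` is nonnegative on a subspace of
  -- dimension at least `N - r`.
  have s3 : 0 ≤ ∑ i ∈ Finset.Ico t (N - r), f i := by
    refine Finset.sum_nonneg fun i hi => ?_
    rw [Finset.mem_Ico] at hi
    obtain ⟨V, hV, hV'⟩ := A.exists_neg_singularValues_le_dilation r
    rw [A.singularValues_eq_zero_iff_le_finrank_range.2 hA, neg_zero] at hV'
    exact hle i (by omega) A _ V hMA (by omega) hV'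
  -- A subspace of dimension at least `N - i` controls the eigenvalues up to index `N - 1 - i`,
  -- hence the reversed indexing.
  have s4 : -∑ i ∈ Finset.range r, B.singularValues i ≤ ∑ i ∈ Finset.range r, f (N - 1 - i) := by
    rw [← Finset.sum_neg_distrib]
    refine Finset.sum_le_sum fun i hi => ?_
    rw [Finset.mem_range] at hi
    obtain ⟨V, hV, hV'⟩ := B.exists_neg_singularValues_le_dilation i
    exact hle _ (by omega) B _ V hMB (by omega) hV'
  linarith

end InnerProduct

/-! ### Transfer to matrices -/

theorem Matrix.finrank_range_toLpLin {m n : ℕ} (X : Matrix (Fin m) (Fin n) ℝ) :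
    Module.finrank ℝ (Matrix.toLpLin 2 2 X).range = X.rank := by
  rw [Matrix.toLpLin_eq_toLin, ← Matrix.rank_eq_finrank_range_toLin]

theorem matrixSingularValue_eq_zero {m n : ℕ} (X : Matrix (Fin m) (Fin n) ℝ) {i : ℕ}
    (hi : X.rank ≤ i) : matrixSingularValue X i = 0 :=
  LinearMap.singularValues_eq_zero_iff_le_finrank_range _ |>.2 (X.finrank_range_toLpLin ▸ hi)

theorem matrixSingularValue_smul {m n : ℕ} (c : ℝ) (X : Matrix (Fin m) (Fin n) ℝ) (i : ℕ) :
    matrixSingularValue (c • X) i = |c| * matrixSingularValue X i := by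
  rw [matrixSingularValue, map_smul, LinearMap.singularValues_smul, matrixSingularValue]

theorem continuous_matrixSingularValue {m n : ℕ} (i : ℕ) :
    Continuous fun X : Matrix (Fin m) (Fin n) ℝ => matrixSingularValue X i := by
  let L : Matrix (Fin m) (Fin n) ℝ →ₗ[ℝ] EuclideanSpace ℝ (Fin n) →L[ℝ] EuclideanSpace ℝ (Fin m) :=
    LinearMap.toContinuousLinearMap.toLinearMap ∘ₗ (Matrix.toLpLin 2 2).toLinearMap
  have hL : Continuous L := L.continuous_of_finiteDimensional
  refine ((LinearMap.continuous_singularValues i).comp hL).congr fun X => ?_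
  rfl

/-- The lower bound for the growth of the nuclear norm at a matrix of rank `r` along `H`. -/
noncomputable def nuclearGap {m n : ℕ} (r : ℕ) (H : Matrix (Fin m) (Fin n) ℝ) : ℝ :=
  ∑ i ∈ Finset.Ico r (min m n), matrixSingularValue H i -
    ∑ i ∈ Finset.range r, matrixSingularValue H i

theorem nuclearGap_smul {m n : ℕ} (r : ℕ) (c : ℝ) (H : Matrix (Fin m) (Fin n) ℝ) :
    nuclearGap r (c • H) = |c| * nuclearGap r H := by
  simp only [nuclearGap, matrixSingularValue_smul, ← Finset.mul_sum, mul_sub]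

theorem continuous_nuclearGap {m n : ℕ} (r : ℕ) :
    Continuous (nuclearGap r : Matrix (Fin m) (Fin n) ℝ → ℝ) :=
  (continuous_finsetSum _ fun _ _ => continuous_matrixSingularValue _).sub
    (continuous_finsetSum _ fun _ _ => continuous_matrixSingularValue _)

theorem Matrix.rank_le_min {m n : ℕ} (X : Matrix (Fin m) (Fin n) ℝ) : X.rank ≤ min m n :=
  le_min (by simpa using X.rank_le_height) (by simpa using X.rank_le_width)

theorem nuclearGap_le_nuclearNorm_sub {m n r : ℕ} (X₀ H : Matrix (Fin m) (Fin n) ℝ)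
    (hr : X₀.rank = r) : nuclearGap r H ≤ nuclearNorm (X₀ + H) - nuclearNorm X₀ := by
  have hrt : r ≤ min m n := hr ▸ X₀.rank_le_min
  have h := LinearMap.sum_singularValues_le_sum_singularValues_sub (r := r) (t := min m n)
    (Matrix.toLpLin 2 2 X₀) (Matrix.toLpLin 2 2 (-H)) (by rw [Matrix.finrank_range_toLpLin, hr])
    hrt (by simp) (by simp)
  rw [← map_sub, sub_neg_eq_add, map_neg, finrank_euclideanSpace_fin] at h
  simp only [LinearMap.singularValues_neg] at h
  change ∑ i ∈ Finset.range r, matrixSingularValue X₀ i +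
    ∑ i ∈ Finset.Ico r (min m n), matrixSingularValue H i -
    ∑ i ∈ Finset.range r, matrixSingularValue H i ≤
    ∑ i ∈ Finset.range n, matrixSingularValue (X₀ + H) i at h
  -- The operator bound sums up to the domain dimension `n`; terms from `min m n` on vanish.
  rw [← Finset.sum_range_add_sum_Ico _ (min_le_right m n), Finset.sum_eq_zero (s := Finset.Ico _ n)
    fun i hi => matrixSingularValue_eq_zero _
      ((Matrix.rank_le_min _).trans (Finset.mem_Ico.1 hi).1)] at h
  have h0 : nuclearNorm X₀ = ∑ i ∈ Finset.range r, matrixSingularValue X₀ i := by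
    rw [nuclearNorm, ← Finset.sum_range_add_sum_Ico _ hrt, Finset.sum_eq_zero (s := Finset.Ico _ _)
      fun i hi => matrixSingularValue_eq_zero _ (hr ▸ (Finset.mem_Ico.1 hi).1), add_zero]
  rw [nuclearGap, h0, nuclearNorm]
  linarith

/-! ### Compactness and conclusion -/

theorem exists_pos_mul_norm_le_of_absHomogeneous {E : Type*} [NormedAddCommGroup E]
    [NormedSpace ℝ E] [FiniteDimensional ℝ E] (K : Submodule ℝ E) {g : E → ℝ} (hg : Continuous g)
    (hsmul : ∀ (c : ℝ) x, g (c • x) = |c| * g x) (hpos : ∀ x ∈ K, x ≠ 0 → 0 < g x) :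
    ∃ κ > 0, ∀ x ∈ K, κ * ‖x‖ ≤ g x := by
  have : ProperSpace E := FiniteDimensional.proper ℝ E
  have hcpt : IsCompact (Metric.sphere (0 : E) 1 ∩ K) :=
    (isCompact_sphere 0 1).inter_right K.closed_of_finiteDimensional
  have hbound : ∃ κ > 0, ∀ x ∈ Metric.sphere (0 : E) 1 ∩ K, κ ≤ g x := by
    rcases (Metric.sphere (0 : E) 1 ∩ K).eq_empty_or_nonempty with h | h
    · exact ⟨1, one_pos, by simp [h]⟩
    · obtain ⟨y, hy, hmin⟩ := hcpt.exists_isMinOn h hg.continuousOn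
      exact ⟨g y, hpos y hy.2 (ne_zero_of_mem_unit_sphere ⟨y, hy.1⟩), fun x hx => hmin hx⟩
  obtain ⟨κ, hκ, hle⟩ := hbound
  refine ⟨κ, hκ, fun x hx => ?_⟩
  by_cases hx0 : x = 0
  · have := hsmul 0 x
    simp_all
  · have hn : 0 < ‖x‖ := norm_pos_iff.2 hx0
    have h := hle (‖x‖⁻¹ • x) ⟨by simp [norm_smul, hn.ne'], K.smul_mem _ hx⟩
    rwa [hsmul, abs_of_pos (inv_pos.2 hn), inv_mul_eq_div, le_div_iff₀ hn] at h

theorem mainTheorem12 (m n p r : ℕ)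
    (Φ : Matrix (Fin m) (Fin n) ℝ →ₗ[ℝ] EuclideanSpace ℝ (Fin p))
    (b₀ : EuclideanSpace ℝ (Fin p)) (X₀ : Matrix (Fin m) (Fin n) ℝ)
    (hX₀ : X₀ ∈ nuclearFeasibleSet Φ b₀) (hr : X₀.rank = r)
    (hΦ : ∀ H ∈ LinearMap.ker Φ, H ≠ 0 →
      ∑ i ∈ Finset.range r, matrixSingularValue H i <
        ∑ i ∈ Finset.Ico r (min m n), matrixSingularValue H i) :
    IsSharpNuclearMinimum Φ b₀ X₀ := by
  obtain ⟨κ, hκ, hle⟩ := exists_pos_mul_norm_le_of_absHomogeneous (LinearMap.ker Φ)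
    (continuous_nuclearGap r) (nuclearGap_smul r) (fun H hH h0 => sub_pos.2 (hΦ H hH h0))
  -- The growth bound holds on the whole feasible set, so the radius `1` is arbitrary.
  refine ⟨hX₀, κ, hκ, 1, one_pos, fun X hX _ => ?_⟩
  have hker : X - X₀ ∈ LinearMap.ker Φ := by
    rw [LinearMap.mem_ker, map_sub, hX.out, hX₀.out, sub_self]
  have h := nuclearGap_le_nuclearNorm_sub X₀ (X - X₀) hr
  rw [add_sub_cancel] at h
  exact (hle _ hker).trans h
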